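/- Let $q\in\mathbb C$ with $0<|q|<1$. Write $(a;q)_\infty=\prod_{k\ge 0}(1-aq^k)$ and, for $n\ge 0$, $(a;q)_n=\prod_{k=0}^{n-1}(1-aq^k)$, $(a;q)_{-n}=\prod_{k=1}^{n}(1-aq^{-k})^{-1}$; moreover $(a_1,\dots,a_m;q)_n=\prod_{i=1}^m(a_i;q)_n$ for $n\in\mathbb Z\cup\{\infty\}$. The bilateral series is $${}_r\psi_r\left[{a_1,\dots,a_r\atop b_1,\dots,b_r};q,x\right]=\sum_{n=-\infty}^{\infty}\frac{(a_1,\dots,a_r;q)_n}{(b_1,\dots,b_r;q)_n}x^n .$$ All series below converge absolutely, and the following identities hold. (1) For nonzero $b,c,d\in\mathbb C$, none of which equals $q^k$ for an integer $k\ge 1$, with $|q/(bcd)|<1$, $${}_3\psi_3\left[{b,c,d\atop q/b,q/c,q/d};q,\frac{q}{bcd}\right]=\frac{(q,q/(bc),q/(bd),q/(cd);q)_\infty}{(q/b,q/c,q/d,q/(bcd);q)_\infty}.$$ (2) For nonzero $b,c,d\in\mathbb C$, none of which equals $q^k$ for an integer $k\ge 0$, with $|1/(bcd)|<1$, $$C_0+\sum_{n=2}^{\infty}\frac{1-q^{2n-1}}{(1-q^{n-1})(1-q^n)}\,\frac{(b,c,d;q)_n}{(1/b,1/c,1/d;q)_n}\left(\frac1{bcd}\right)^n=\frac{(q,1/(bc),1/(bd),1/(cd);q)_\infty}{(1/b,1/c,1/d,1/(bcd);q)_\infty},$$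 where $$C_0=\frac{2bcdq-bcd-bcq-bdq-cdq+b+c+d+q-2}{(1-q)(1-b)(1-c)(1-d)}.$$ (3) (The case $b=c=d$ of (2).) For $b\in\mathbb C$ with $|b|>1$, $$\sum_{n=2}^{\infty}\frac{1-q^{2n-1}}{(1-q^{n-1})(1-q^n)}\,\frac{(b;q)_n^3}{(1/b;q)_n^3}\left(\frac1b\right)^{3n}=(q;q)_\infty\frac{(-1/b;q)_\infty^3\,(q/b^2;q^2)_\infty^3}{(1/b^3;q)_\infty}+\frac{-2bq+b-q+2}{(1-b)(1-q)}.$$ (4) (The limiting case $b,c,d\to\infty$ of (2).) $$\sum_{n=2}^{\infty}\frac{1-q^{2n-1}}{(1-q^{n-1})(1-q^n)}(-1)^nq^{3n(n-1)/2}=(q;q)_\infty-\frac{1-2q}{1-q}.$$ -/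

import Mathlib

noncomputable section

/-- The infinite `q`-shifted factorial `(a; q)_∞ = ∏_{k ≥ 0} (1 - a q^k)`
(the product converges absolutely for `|q| < 1`). -/
def qPochInf (a q : ℂ) : ℂ := ∏' k : ℕ, (1 - a * q ^ k)

/-- The `q`-shifted factorial `(a; q)_n` for `n : ℤ`:
`(a; q)_n = (1 - a)(1 - a q) ⋯ (1 - a q^(n-1))` for `n ≥ 0`, and
`(a; q)_(-n) = 1 / ((1 - a q^(-1))(1 - a q^(-2)) ⋯ (1 - a q^(-n)))` for `n ≥ 1`.
It is the quotient `(a; q)_∞ / (a q^n; q)_∞` with the common factors cancelled, see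
`qPoch_eq_div`. -/
def qPoch (a q : ℂ) : ℤ → ℂ
  | Int.ofNat n => ∏ k ∈ Finset.range n, (1 - a * q ^ k)
  | Int.negSucc n => (∏ k ∈ Finset.range (n + 1), (1 - a / q ^ (k + 1)))⁻¹

theorem multipliable_qPochInf (a q : ℂ) (hq : ‖q‖ < 1) :
    Multipliable fun k : ℕ => (1 - a * q ^ k) := by
  have h : Summable fun k : ℕ => ‖-(a * q ^ k)‖ := by
    simpa [norm_mul, norm_pow] using
      (summable_geometric_of_lt_one (norm_nonneg q) hq).mul_left ‖a‖
  simpa [sub_eq_add_neg] using multipliable_one_add_of_summable h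

theorem qPochInf_split (a q : ℂ) (hq : ‖q‖ < 1) (n : ℕ) :
    qPochInf a q = (∏ k ∈ Finset.range n, (1 - a * q ^ k)) * qPochInf (a * q ^ n) q := by
  induction n with
  | zero => simp
  | succ n ih =>
    have h : qPochInf (a * q ^ n) q
        = (1 - a * q ^ n) * qPochInf (a * q ^ (n + 1)) q := by
      have h1 := multipliable_qPochInf (a * q ^ (n + 1)) q hq
      have h2 : ∀ k : ℕ, 1 - a * q ^ n * q ^ (k + 1) = 1 - a * q ^ (n + 1) * q ^ k := by
        intro k; ring
      unfold qPochInf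
      rw [tprod_eq_zero_mul' (by simpa only [h2] using h1)]
      simp only [h2, pow_zero, mul_one]
    rw [ih, h, Finset.prod_range_succ, mul_assoc]

theorem qPoch_eq_div (a q : ℂ) (hq0 : q ≠ 0) (hq : ‖q‖ < 1) (n : ℤ)
    (h : qPochInf (a * q ^ n) q ≠ 0) :
    qPoch a q n = qPochInf a q / qPochInf (a * q ^ n) q := by
  cases n with
  | ofNat n =>
    have h' : qPochInf (a * q ^ n) q ≠ 0 := by simpa using h
    simp only [qPoch, Int.ofNat_eq_natCast, zpow_natCast]
    rw [eq_div_iff h', ← qPochInf_split a q hq n]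
  | negSucc n =>
    have e := qPochInf_split (a * q ^ (Int.negSucc n)) q hq (n + 1)
    have e1 : a * q ^ (Int.negSucc n) * q ^ (n + 1) = a := by
      rw [zpow_negSucc, mul_assoc, inv_mul_cancel₀ (pow_ne_zero _ hq0), mul_one]
    have e2 : ∏ k ∈ Finset.range (n + 1), (1 - a * q ^ (Int.negSucc n) * q ^ k)
        = ∏ k ∈ Finset.range (n + 1), (1 - a / q ^ (k + 1)) := by
      rw [← Finset.prod_range_reflect]
      refine Finset.prod_congr rfl fun k hk => ?_
      have hk' : k ≤ n := Nat.lt_succ_iff.mp (Finset.mem_range.mp hk)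
      obtain ⟨m, rfl⟩ := Nat.exists_eq_add_of_le hk'
      have : k + m + 1 - 1 - k = m := by omega
      rw [this, zpow_negSucc]
      field_simp
      ring
    rw [e1, e2] at e
    rw [e] at h ⊢
    have hA : qPochInf a q ≠ 0 := right_ne_zero_of_mul h
    simp only [qPoch]
    rw [div_mul_cancel_right₀ hA]

/-- `(a_1, …, a_m; q)_∞`. -/
def qPochInfMulti {m : ℕ} (a : Fin m → ℂ) (q : ℂ) : ℂ := ∏ i, qPochInf (a i) q

/-- `(a_1, …, a_m; q)_n`. -/
def qPochMulti {m : ℕ} (a : Fin m → ℂ) (q : ℂ) (n : ℤ) : ℂ := ∏ i, qPoch (a i) q n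

/-- The `n`-th term of the bilateral basic hypergeometric series `_rψ_r[a; b; q, x]`. -/
def psiTerm {r : ℕ} (a b : Fin r → ℂ) (q x : ℂ) (n : ℤ) : ℂ :=
  qPochMulti a q n / qPochMulti b q n * x ^ n

/-- The bilateral basic hypergeometric series `_rψ_r[a; b; q, x]`. -/
def bilateralPsi {r : ℕ} (a b : Fin r → ℂ) (q x : ℂ) : ℂ := ∑' n : ℤ, psiTerm a b q x n

/-- The constant `C_0`. -/
def constC (q b c d : ℂ) : ℂ :=
  (2 * b * c * d * q - b * c * d - b * c * q - b * d * q - c * d * q + b + c + d + q - 2) /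
    ((1 - q) * (1 - b) * (1 - c) * (1 - d))

/-- The factor `(1 - q^(2n-1)) / ((1 - q^(n-1)) (1 - q^n))`, used for `n ≥ 2` only. -/
def lambertFactor (q : ℂ) (n : ℕ) : ℂ :=
  (1 - q ^ (2 * n - 1)) / ((1 - q ^ (n - 1)) * (1 - q ^ n))

end

/-!
Both summations are limits of the nonterminating very-well-poised `₆φ₅` sum, the first at `a = 1` and
the second at `a = 1 / q`. They are proved together. With `p = a q` and the reciprocal parameters
`β = 1 / b`, `γ = 1 / c`, `δ = 1 / d`, let `F(β, γ, δ)` be the well-poised series, completed by its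
exceptional first terms (`wpSum`).

* A rational companion (`wpFlux`) makes a combination of the terms at `δ` and at `δ q` telescope
  (`wpTerm_recurrence`), which gives the contiguous relation
  `(1 - p δ) (1 - p β γ δ) F(β, γ, δ) = (1 - p β δ) (1 - p γ δ) F(β, γ, δ q)` (`wpSum_recurrence`).
* Iterating it and letting `δ q^N → 0`, where dominated convergence applies, expresses `F(β, γ, δ)`
  through `F(β, γ, 0)`. As `F` is symmetric, the same step in `γ` and in `β` reduces it to
  `F(0, 0, 0)`; convergence is never lost on the way, since a vanishing parameter makes the series
  converge whatever the others are (`WellPoised.wpSum_eq`).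
* At `δ = 1` when `a = 1`, and at `δ = q` when `a = 1 / q`, the series terminates, and the same
  relation shows that `F(0, 0, 0) = (q; q)_∞` (`WellPoised.wpSum_zero`).

For `a = 1` the series is the bilateral one folded by `n ↦ -n` (`hasSum_psiTerm`). For `a = 1 / q`,
divided by the vanishing factor `1 - a q`, it is the series with the constant `C_0`
(`hasSum_lambert`); the value at `β = γ = δ = 0` is the limiting case `b, c, d → ∞`, so this needs
no further passage to the limit, and `b = c = d` is simplified by `qPochInf_sq`.
-/

noncomputable section WellPoisedSeries

open Filter Topology

/-! ### Powers of `q` and infinite products -/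

theorem tendsto_pow_q {q : ℂ} (hq : ‖q‖ < 1) : Tendsto (fun k : ℕ => q ^ k) atTop (𝓝 0) :=
  tendsto_pow_atTop_nhds_zero_of_norm_lt_one hq

theorem norm_mul_pow_lt_one {q x : ℂ} (hq : ‖q‖ < 1) (h : ‖x‖ < 1) (N : ℕ) :
    ‖x * q ^ N‖ < 1 := by
  rw [norm_mul, norm_pow]
  exact (mul_le_of_le_one_right (norm_nonneg _) (pow_le_one₀ (norm_nonneg _) hq.le)).trans_lt h

theorem one_sub_pow_succ_ne_zero {q : ℂ} (hq : ‖q‖ < 1) (k : ℕ) : 1 - q ^ (k + 1) ≠ 0 := by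
  intro h
  have h1 : ‖q ^ (k + 1)‖ < 1 := by
    rw [norm_pow]
    exact pow_lt_one₀ (norm_nonneg _) hq k.succ_ne_zero
  rw [← sub_eq_zero.1 h, norm_one] at h1
  exact lt_irrefl _ h1

/-- The ratio test with the ratio given as a factor, so that `u` may vanish. -/
theorem summable_of_ratio_tendsto {u r : ℕ → ℂ} {L : ℂ} (h : ∀ n, u (n + 1) = u n * r n)
    (hr : Tendsto r atTop (𝓝 L)) (hL : ‖L‖ < 1) : Summable fun n => ‖u n‖ := by
  obtain ⟨s, hs1, hs2⟩ := exists_between hL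
  refine summable_of_ratio_norm_eventually_le (r := s) hs2 ?_
  filter_upwards [hr.norm.eventually_lt_const hs1] with n hn
  rw [norm_norm, norm_norm, h, norm_mul, mul_comm]
  exact mul_le_mul_of_nonneg_right hn.le (norm_nonneg _)

theorem hasSum_subtype_two_le {f : ℕ → ℂ} {a : ℂ} (h : HasSum (fun j => f (j + 2)) a) :
    HasSum (fun n : {n : ℕ // 2 ≤ n} => f n) a := by
  let e : ℕ ≃ {n : ℕ // 2 ≤ n} :=
    ⟨fun j => ⟨j + 2, by omega⟩, fun n => n.1 - 2, fun j => by simp,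
      fun n => Subtype.ext (Nat.sub_add_cancel n.2)⟩
  exact e.hasSum_iff.1 h

theorem qPochInf_zero (q : ℂ) : qPochInf 0 q = 1 := by simp [qPochInf]

theorem tendsto_prod_qPochInf (a : ℂ) {q : ℂ} (hq : ‖q‖ < 1) :
    Tendsto (fun N => ∏ k ∈ Finset.range N, (1 - a * q ^ k)) atTop (𝓝 (qPochInf a q)) :=
  (multipliable_qPochInf a q hq).hasProd.tendsto_prod_nat

theorem qPochInf_ne_zero {a q : ℂ} (hq : ‖q‖ < 1) (h : ∀ k : ℕ, 1 - a * q ^ k ≠ 0) :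
    qPochInf a q ≠ 0 := by
  have hs : Summable fun k : ℕ => ‖-(a * q ^ k)‖ := by
    simpa [norm_mul, norm_pow] using
      (summable_geometric_of_lt_one (norm_nonneg q) hq).mul_left ‖a‖
  have := tprod_one_add_ne_zero_of_summable (f := fun k : ℕ => -(a * q ^ k))
    (fun k => by simpa [sub_eq_add_neg] using h k) hs
  simpa [qPochInf, sub_eq_add_neg] using this

/-- Splitting `(x²; q)_∞` into even and odd factors, and the even ones as differences of squares. -/
theorem qPochInf_sq {q : ℂ} (hq : ‖q‖ < 1) (x : ℂ) :
    qPochInf (x ^ 2) q = qPochInf x q * qPochInf (-x) q * qPochInf (q * x ^ 2) (q ^ 2) := by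
  have hq2 : ‖q ^ 2‖ < 1 := by
    rw [norm_pow]
    exact pow_lt_one₀ (norm_nonneg _) hq two_ne_zero
  have hl := (tendsto_prod_qPochInf (x ^ 2) hq).comp
    (tendsto_atTop_mono (fun N : ℕ => (by omega : N ≤ 2 * N)) tendsto_id)
  have hr := ((tendsto_prod_qPochInf x hq).mul (tendsto_prod_qPochInf (-x) hq)).mul
    (tendsto_prod_qPochInf (q * x ^ 2) hq2)
  refine tendsto_nhds_unique hl (hr.congr fun N => ?_)
  simp only [Function.comp_apply]
  induction N with
  | zero => simp
  | succ N ih =>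
    rw [Nat.mul_succ, Finset.prod_range_succ _ (2 * N + 1), Finset.prod_range_succ _ (2 * N), ← ih]
    simp only [Finset.prod_range_succ]
    ring

/-! ### The well-poised term and its telescoping companion -/

/-- The product `∏_{k<n} (β - q^k) / (1 - p β q^k)`. For `β = 1 / b` it equals
`(b; q)_n / (p / b; q)_n * b^(-n)`; written in `β` it also makes sense at `β = 0`, that is, at
`b = ∞`. -/
def wpFactor (p q β : ℂ) (n : ℕ) : ℂ :=
  ∏ k ∈ Finset.range n, (β - q ^ k) / (1 - p * β * q ^ k)

/-- The term of index `n = j + 1` of the well-poised series with base `a = p / q` and parameters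
`1 / β, 1 / γ, 1 / δ`. The weight `v j` stands for `(p; q)_{n-1} / (q; q)_n`,
stripped of the factor `1 - p` if that vanishes. -/
def wpTerm (p q : ℂ) (v : ℕ → ℂ) (β γ δ : ℂ) (j : ℕ) : ℂ :=
  (1 - p * q ^ (2 * j + 1)) * v j *
    (p ^ (j + 1) * (wpFactor p q β (j + 1) * wpFactor p q γ (j + 1) * wpFactor p q δ (j + 1)))

/-- The companion of `wpTerm` under the shift `δ ↦ δ q`, found by `q`-Gosper summation: its
differences are the combination of terms in `wpTerm_recurrence`. -/
def wpFlux (p q : ℂ) (v : ℕ → ℂ) (β γ δ : ℂ) (j : ℕ) : ℂ :=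
  -(δ * (1 - p * δ)) * (v j * (1 - q ^ (j + 1))) * p *
    ((β - q ^ j) * (γ - q ^ j) / (1 - p * δ * q ^ j)) *
    (p ^ j * (wpFactor p q β j * wpFactor p q γ j * wpFactor p q δ j))

/-- No factor `1 - p β q^k` in a denominator of `wpFactor p q β` vanishes. -/
def Admissible (p q β : ℂ) : Prop := ∀ k : ℕ, 1 - p * β * q ^ k ≠ 0

theorem Admissible.zero (p q : ℂ) : Admissible p q 0 := fun k => by simp

theorem Admissible.mul_pow {p q β : ℂ} (h : Admissible p q β) (N : ℕ) :
    Admissible p q (β * q ^ N) := fun k => by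
  have := h (N + k)
  rwa [pow_add, ← mul_assoc, mul_assoc p] at this

theorem wpFactor_succ (p q β : ℂ) (n : ℕ) :
    wpFactor p q β (n + 1) = wpFactor p q β n * ((β - q ^ n) / (1 - p * β * q ^ n)) :=
  Finset.prod_range_succ _ _

theorem wpFactor_shift {p q δ : ℂ} (h : Admissible p q δ) (j : ℕ) :
    wpFactor p q (δ * q) (j + 1) = wpFactor p q δ j *
      (q ^ j * (δ * q - 1) * (1 - p * δ) / ((1 - p * δ * q ^ j) * (1 - p * δ * q ^ (j + 1)))) := by
  induction j with
  | zero =>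
    have h0 := h 0
    have h1 := h 1
    simp only [wpFactor, Finset.prod_range_succ, Finset.prod_range_zero, pow_zero, mul_one,
      zero_add, pow_one, one_mul] at h0 h1 ⊢
    rw [← mul_assoc p δ q, mul_comm (1 - p * δ) (1 - p * δ * q), mul_div_mul_right _ _ h0]
  | succ j ih =>
    rw [wpFactor_succ, ih, wpFactor_succ]
    have h0 := h j
    have h1 := h (j + 1)
    have h2 := h (j + 2)
    have e : p * (δ * q) * q ^ (j + 1) = p * δ * q ^ (j + 2) := by ring
    rw [e]
    field_simp
    ring

/-- The telescoping identity (a WZ pair) behind the contiguous relation `wpSum_recurrence`. -/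
theorem wpTerm_recurrence {p q : ℂ} {v : ℕ → ℂ} {β γ δ : ℂ} (hβ : Admissible p q β)
    (hγ : Admissible p q γ) (hδ : Admissible p q δ) {j : ℕ}
    (hv : v (j + 1) * (1 - q ^ (j + 2)) = v j * (1 - p * q ^ j)) :
    (1 - p * δ) * (1 - p * β * γ * δ) * wpTerm p q v β γ δ j
      - (1 - p * β * δ) * (1 - p * γ * δ) * wpTerm p q v β γ (δ * q) j
      = wpFlux p q v β γ δ (j + 1) - wpFlux p q v β γ δ j := by
  unfold wpTerm wpFlux
  rw [hv, wpFactor_shift hδ]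
  simp only [wpFactor_succ]
  have b0 := hβ j
  have c0 := hγ j
  have d0 := hδ j
  have d1 := hδ (j + 1)
  generalize wpFactor p q β j = B
  generalize wpFactor p q γ j = C
  generalize wpFactor p q δ j = D
  generalize v j = V
  have e2 : q ^ (2 * j + 1) = q ^ j * q ^ j * q := by ring
  rw [pow_succ q j] at *
  rw [e2, pow_succ p j]
  clear e2 hv hβ hγ hδ
  generalize q ^ j = X at *
  generalize p ^ j = Y
  rw [← mul_assoc (p * δ) X q] at *
  field_simp
  ring

/-! ### Convergence -/

theorem tendsto_wpRatio (p β : ℂ) {q : ℂ} (hq : ‖q‖ < 1) :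
    Tendsto (fun k : ℕ => (β - q ^ k) / (1 - p * β * q ^ k)) atTop (𝓝 β) := by
  have h := tendsto_pow_q hq
  have := (h.const_sub β).div ((h.const_mul (p * β)).const_sub 1) (by simp)
  simp only [sub_zero, mul_zero, div_one] at this
  exact this

theorem summable_wpProduct {p q β γ δ : ℂ} (hq : ‖q‖ < 1) (h : ‖p * β * γ * δ‖ < 1) :
    Summable fun j =>
      ‖p ^ j * (wpFactor p q β j * wpFactor p q γ j * wpFactor p q δ j)‖ := by
  refine summable_of_ratio_tendsto (L := p * β * γ * δ)
    (r := fun k => p * ((β - q ^ k) / (1 - p * β * q ^ k)) * ((γ - q ^ k) / (1 - p * γ * q ^ k)) *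
      ((δ - q ^ k) / (1 - p * δ * q ^ k))) (fun n => ?_) ?_ h
  · simp only [wpFactor_succ]; ring
  · exact (((tendsto_wpRatio p β hq).const_mul p).mul (tendsto_wpRatio p γ hq)).mul
      (tendsto_wpRatio p δ hq)

theorem tendsto_weight {p q l : ℂ} {v : ℕ → ℂ} (hq : ‖q‖ < 1) (hv : Tendsto v atTop (𝓝 l)) :
    Tendsto (fun j => (1 - p * q ^ (2 * j + 1)) * v j) atTop (𝓝 l) := by
  have h := (tendsto_pow_q hq).comp
    (tendsto_atTop_mono (fun j : ℕ => (by omega : j ≤ 2 * j + 1)) tendsto_id)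
  simpa using ((h.const_mul p).const_sub 1).mul hv

theorem summable_wpTerm {p q l β γ δ : ℂ} {v : ℕ → ℂ} (hq : ‖q‖ < 1)
    (hv : Tendsto v atTop (𝓝 l)) (h : ‖p * β * γ * δ‖ < 1) :
    Summable (wpTerm p q v β γ δ) := by
  have hs := (summable_nat_add_iff 1).2 (summable_wpProduct (p := p) (β := β) (γ := γ) (δ := δ) hq h)
  refine summable_of_isBigO_nat hs ?_
  have := ((tendsto_weight (p := p) hq hv).isBigO_one ℝ).mul
    (Asymptotics.isBigO_norm_right.2 (Asymptotics.isBigO_refl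
      (fun j => p ^ (j + 1) * (wpFactor p q β (j + 1) * wpFactor p q γ (j + 1) *
        wpFactor p q δ (j + 1))) atTop))
  simp only [one_mul] at this
  exact this

theorem tendsto_wpFlux {p q l β γ δ : ℂ} {v : ℕ → ℂ} (hq : ‖q‖ < 1)
    (hv : Tendsto v atTop (𝓝 l)) (h : ‖p * β * γ * δ‖ < 1) :
    Tendsto (wpFlux p q v β γ δ) atTop (𝓝 0) := by
  have hs := (summable_wpProduct (p := p) (β := β) (γ := γ) (δ := δ) hq h).of_norm.tendsto_atTop_zero
  have hX := tendsto_pow_q hq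
  have h1 := hv.mul (((tendsto_add_atTop_iff_nat 1).2 hX).const_sub 1)
  have h2 := (((hX.const_sub β).mul (hX.const_sub γ)).div
    ((hX.const_mul (p * δ)).const_sub 1) (by simp))
  have := (((h1.const_mul (-(δ * (1 - p * δ)))).mul_const p).mul h2).mul hs
  rw [mul_zero] at this
  exact this

/-! ### The contiguous relation -/

/-- The well-poised series from index `m` on, with `c` in place of its first terms. -/
def wpSum (p q : ℂ) (v : ℕ → ℂ) (c : ℂ → ℂ → ℂ → ℂ) (m : ℕ) (β γ δ : ℂ) : ℂ :=
  c β γ δ + ∑' j, wpTerm p q v β γ δ (j + m)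

/-- The contiguous relation in `δ`: summing `wpTerm_recurrence` leaves the boundary value of
`wpFlux` at `m`, which `c` compensates. -/
theorem wpSum_recurrence {p q l β γ δ : ℂ} {v : ℕ → ℂ} {c : ℂ → ℂ → ℂ → ℂ} {m : ℕ}
    (hq : ‖q‖ < 1) (hv : Tendsto v atTop (𝓝 l))
    (hrec : ∀ j, m ≤ j → v (j + 1) * (1 - q ^ (j + 2)) = v j * (1 - p * q ^ j))
    (hβ : Admissible p q β) (hγ : Admissible p q γ) (hδ : Admissible p q δ)
    (hc : (1 - p * δ) * (1 - p * β * γ * δ) * c β γ δ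
      - (1 - p * β * δ) * (1 - p * γ * δ) * c β γ (δ * q) = wpFlux p q v β γ δ m)
    (h : ‖p * β * γ * δ‖ < 1) :
    (1 - p * δ) * (1 - p * β * γ * δ) * wpSum p q v c m β γ δ =
      (1 - p * β * δ) * (1 - p * γ * δ) * wpSum p q v c m β γ (δ * q) := by
  have h' : ‖p * β * γ * (δ * q)‖ < 1 := by
    simpa [mul_assoc] using norm_mul_pow_lt_one hq h 1
  have s1 := ((summable_nat_add_iff m).2 (summable_wpTerm hq hv h)).hasSum.mul_left
    ((1 - p * δ) * (1 - p * β * γ * δ))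
  have s2 := ((summable_nat_add_iff m).2 (summable_wpTerm hq hv h')).hasSum.mul_left
    ((1 - p * β * δ) * (1 - p * γ * δ))
  have s := (s1.sub s2).tendsto_sum_nat
  -- the partial sums telescope
  have e : ∀ n, ∑ j ∈ Finset.range n,
      ((1 - p * δ) * (1 - p * β * γ * δ) * wpTerm p q v β γ δ (j + m)
      - (1 - p * β * δ) * (1 - p * γ * δ) * wpTerm p q v β γ (δ * q) (j + m))
      = wpFlux p q v β γ δ (n + m) - wpFlux p q v β γ δ m := fun n => by
    have : ∀ j, (1 - p * δ) * (1 - p * β * γ * δ) * wpTerm p q v β γ δ (j + m)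
        - (1 - p * β * δ) * (1 - p * γ * δ) * wpTerm p q v β γ (δ * q) (j + m)
        = wpFlux p q v β γ δ (j + 1 + m) - wpFlux p q v β γ δ (j + m) := fun j => by
      rw [wpTerm_recurrence hβ hγ hδ (hrec _ (Nat.le_add_left m j)), add_right_comm]
    simp only [this]
    rw [Finset.sum_range_sub (fun j => wpFlux p q v β γ δ (j + m)), zero_add]
  simp only [e] at s
  have t := ((tendsto_add_atTop_iff_nat m).2 (tendsto_wpFlux hq hv h)).sub_const
    (wpFlux p q v β γ δ m)
  have := tendsto_nhds_unique s t
  unfold wpSum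
  linear_combination this + hc

/-! ### Sending a parameter to zero -/

/-- A bound for `wpFactor` uniform over a small disc in the parameter. -/
theorem norm_wpFactor_le {p q δ : ℂ} {ε : ℝ} (hq : ‖q‖ < 1) (hδ : ‖δ‖ ≤ ε)
    (hε : ‖p‖ * ε ≤ 1 / 2) (n : ℕ) :
    ‖wpFactor p q δ n‖ ≤ ∏ k ∈ Finset.range n, (2 * (ε + ‖q‖ ^ k)) := by
  rw [wpFactor, norm_prod]
  refine Finset.prod_le_prod (fun _ _ => norm_nonneg _) fun k _ => ?_
  have hε0 : 0 ≤ ε := (norm_nonneg _).trans hδ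
  have hqk : ‖q‖ ^ k ≤ 1 := pow_le_one₀ (norm_nonneg _) hq.le
  have hden : 1 / 2 ≤ ‖1 - p * δ * q ^ k‖ := by
    have h1 : ‖p * δ * q ^ k‖ ≤ 1 / 2 := by
      rw [norm_mul, norm_mul, norm_pow]
      calc ‖p‖ * ‖δ‖ * ‖q‖ ^ k ≤ ‖p‖ * ε * 1 := by gcongr
        _ ≤ 1 / 2 := by linarith
    have h2 := norm_sub_norm_le (1 : ℂ) (p * δ * q ^ k)
    rw [norm_one] at h2
    linarith
  have hnum : ‖δ - q ^ k‖ ≤ ε + ‖q‖ ^ k := by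
    have := norm_sub_le δ (q ^ k)
    rw [norm_pow] at this
    linarith
  rw [norm_div, div_le_iff₀ (by linarith)]
  have : 0 ≤ ε + ‖q‖ ^ k := (norm_nonneg _).trans hnum
  nlinarith

theorem tendsto_wpFactor {p q δ : ℂ} (hq : ‖q‖ < 1) (n : ℕ) :
    Tendsto (fun N : ℕ => wpFactor p q (δ * q ^ N) n) atTop (𝓝 (wpFactor p q 0 n)) := by
  have h : Tendsto (fun N : ℕ => δ * q ^ N) atTop (𝓝 0) := by
    simpa using (tendsto_pow_q hq).const_mul δ
  refine tendsto_finsetProd _ fun k _ => ?_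
  exact (h.sub_const _).div (((h.const_mul p).mul_const _).const_sub 1) (by simp)

/-- The series is continuous along `δ q^N → 0`, by dominated convergence. -/
theorem tendsto_tsum_wpTerm {p q l β γ : ℂ} (δ : ℂ) {v : ℕ → ℂ} (hq : ‖q‖ < 1)
    (hv : Tendsto v atTop (𝓝 l)) (m : ℕ) :
    Tendsto (fun N : ℕ => ∑' j, wpTerm p q v β γ (δ * q ^ N) (j + m)) atTop
      (𝓝 (∑' j, wpTerm p q v β γ 0 (j + m))) := by
  have hz : Tendsto (fun N : ℕ => δ * q ^ N) atTop (𝓝 0) := by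
    simpa using (tendsto_pow_q hq).const_mul δ
  -- any `ε` with `2 ε |p β γ| < 1` gives a geometric dominating series
  obtain ⟨ε, hε0, hε1, hε2⟩ : ∃ ε : ℝ, 0 < ε ∧ ‖p‖ * ε ≤ 1 / 2 ∧ ‖p * β * γ‖ * (2 * ε) < 1 := by
    refine ⟨1 / (2 * (1 + ‖p‖ + ‖p * β * γ‖)), by positivity, ?_, ?_⟩
    · have := norm_nonneg p
      have := norm_nonneg (p * β * γ)
      rw [mul_one_div, div_le_iff₀ (by positivity)]
      linarith
    · have := norm_nonneg p
      have := norm_nonneg (p * β * γ)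
      rw [show 2 * (1 / (2 * (1 + ‖p‖ + ‖p * β * γ‖))) = 1 / (1 + ‖p‖ + ‖p * β * γ‖) by
        field_simp, mul_one_div, div_lt_iff₀ (by positivity)]
      linarith
  -- `M n` bounds `wpFactor p q (δ q^N) n` for all large `N`; its ratios tend to `2 ε`
  set M : ℕ → ℝ := fun n => ∏ k ∈ Finset.range n, (2 * (ε + ‖q‖ ^ k)) with hM
  have hM0 : ∀ n, 0 ≤ M n := fun n => Finset.prod_nonneg fun k _ => by positivity
  set u : ℕ → ℂ := fun n => p ^ n * (wpFactor p q β n * wpFactor p q γ n * (M n : ℂ)) with hu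
  have hsu : Summable fun n => ‖u n‖ := by
    refine summable_of_ratio_tendsto (L := p * β * γ * (2 * (ε + 0) : ℝ))
      (r := fun k => p * ((β - q ^ k) / (1 - p * β * q ^ k)) *
        ((γ - q ^ k) / (1 - p * γ * q ^ k)) * (2 * (ε + ‖q‖ ^ k) : ℝ)) (fun n => ?_) ?_ ?_
    · simp only [hu, hM, wpFactor_succ, Finset.prod_range_succ]
      push_cast
      ring
    · refine (((tendsto_wpRatio p β hq).const_mul p).mul (tendsto_wpRatio p γ hq)).mul ?_
      refine (Complex.continuous_ofReal.tendsto _).comp ?_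
      exact ((tendsto_pow_atTop_nhds_zero_of_lt_one (norm_nonneg q) hq).const_add ε).const_mul 2
    · rw [norm_mul, Complex.norm_real, add_zero, Real.norm_of_nonneg (by positivity)]
      exact hε2
  set b : ℕ → ℝ := fun j => ‖(1 - p * q ^ (2 * j + 1)) * v j * u (j + 1)‖ with hb
  have hsb : Summable b := by
    refine summable_of_isBigO_nat ((summable_nat_add_iff 1).2 hsu) ?_
    simpa only [one_mul] using (((tendsto_weight (p := p) hq hv).isBigO_one ℝ).mul
      (Asymptotics.isBigO_norm_right.2
        (Asymptotics.isBigO_refl (fun j => u (j + 1)) atTop))).norm_left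
  refine tendsto_tsum_of_dominated_convergence ((summable_nat_add_iff m).2 hsb) (fun j => ?_) ?_
  · exact (((tendsto_wpFactor hq _).const_mul _).const_mul _).const_mul _
  · filter_upwards [hz.norm.eventually_le_const (by simpa using hε0)] with N hN j
    simp only [hb, hu, wpTerm, norm_mul, Complex.norm_real, Real.norm_of_nonneg (hM0 _)]
    gcongr
    exact norm_wpFactor_le hq hN hε1 _

/-! ### Evaluation of the series -/

/-- Weights `v` and an initial part `c` for which `wpSum p q v c m` is symmetric in its parameters,
satisfies the contiguous relation, and is continuous where a parameter tends to zero. -/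
structure WellPoised (p q : ℂ) (v : ℕ → ℂ) (c : ℂ → ℂ → ℂ → ℂ) (m : ℕ) : Prop where
  tendsto_one : Tendsto v atTop (𝓝 1)
  weight_succ : ∀ j, m ≤ j → v (j + 1) * (1 - q ^ (j + 2)) = v j * (1 - p * q ^ j)
  swap_left : ∀ β γ δ, c β γ δ = c γ β δ
  swap_right : ∀ β γ δ, c β γ δ = c β δ γ
  initial : ∀ β γ δ, Admissible p q β → Admissible p q γ → Admissible p q δ →
    (1 - p * δ) * (1 - p * β * γ * δ) * c β γ δ
      - (1 - p * β * δ) * (1 - p * γ * δ) * c β γ (δ * q) = wpFlux p q v β γ δ m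
  initial_tendsto : ∀ β γ, Admissible p q β → Admissible p q γ →
    Tendsto (c β γ) (𝓝 0) (𝓝 (c β γ 0))

namespace WellPoised

variable {p q : ℂ} {v : ℕ → ℂ} {c : ℂ → ℂ → ℂ → ℂ} {m : ℕ}

theorem wpSum_swap_left (H : WellPoised p q v c m) (β γ δ : ℂ) :
    wpSum p q v c m β γ δ = wpSum p q v c m γ β δ := by
  simp only [wpSum, H.swap_left β γ δ, wpTerm, mul_comm (wpFactor p q β _)]

theorem wpSum_swap_right (H : WellPoised p q v c m) (β γ δ : ℂ) :
    wpSum p q v c m β γ δ = wpSum p q v c m β δ γ := by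
  simp only [wpSum, H.swap_right β γ δ, wpTerm, mul_right_comm _ (wpFactor p q γ _)]

theorem wpSum_iterate (H : WellPoised p q v c m) (hq : ‖q‖ < 1) {β γ δ : ℂ}
    (hβ : Admissible p q β) (hγ : Admissible p q γ) (hδ : Admissible p q δ)
    (h : ‖p * β * γ * δ‖ < 1) (N : ℕ) :
    (∏ k ∈ Finset.range N, (1 - p * δ * q ^ k)) *
        (∏ k ∈ Finset.range N, (1 - p * β * γ * δ * q ^ k)) * wpSum p q v c m β γ δ =
      (∏ k ∈ Finset.range N, (1 - p * β * δ * q ^ k)) *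
        (∏ k ∈ Finset.range N, (1 - p * γ * δ * q ^ k)) *
          wpSum p q v c m β γ (δ * q ^ N) := by
  induction N with
  | zero => simp
  | succ N ih =>
    have h' : ‖p * β * γ * (δ * q ^ N)‖ < 1 := by
      simpa [mul_assoc] using norm_mul_pow_lt_one hq h N
    have := wpSum_recurrence hq H.tendsto_one H.weight_succ hβ hγ (hδ.mul_pow N)
      (H.initial β γ _ hβ hγ (hδ.mul_pow N)) h'
    rw [mul_assoc δ, ← pow_succ] at this
    simp only [Finset.prod_range_succ]
    linear_combination (1 - p * δ * q ^ N) * (1 - p * β * γ * δ * q ^ N) * ih +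
      (∏ k ∈ Finset.range N, (1 - p * β * δ * q ^ k)) *
        (∏ k ∈ Finset.range N, (1 - p * γ * δ * q ^ k)) * this

/-- The contiguous relation iterated infinitely often reduces `δ` to `0`. -/
theorem wpSum_eq_zero_right (H : WellPoised p q v c m) (hq : ‖q‖ < 1) {β γ δ : ℂ}
    (hβ : Admissible p q β) (hγ : Admissible p q γ) (hδ : Admissible p q δ)
    (h : ‖p * β * γ * δ‖ < 1) :
    qPochInf (p * δ) q * qPochInf (p * β * γ * δ) q * wpSum p q v c m β γ δ =
      qPochInf (p * β * δ) q * qPochInf (p * γ * δ) q * wpSum p q v c m β γ 0 := by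
  have hz : Tendsto (fun N : ℕ => δ * q ^ N) atTop (𝓝 0) := by
    simpa using (tendsto_pow_q hq).const_mul δ
  have h1 := ((tendsto_prod_qPochInf (p * δ) hq).mul
    (tendsto_prod_qPochInf (p * β * γ * δ) hq)).mul_const (wpSum p q v c m β γ δ)
  have h2 := ((tendsto_prod_qPochInf (p * β * δ) hq).mul
    (tendsto_prod_qPochInf (p * γ * δ) hq)).mul
    (((H.initial_tendsto β γ hβ hγ).comp hz).add
      (tendsto_tsum_wpTerm (β := β) (γ := γ) (p := p) δ hq H.tendsto_one m))
  refine tendsto_nhds_unique h1 (h2.congr fun N => ?_)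
  exact (H.wpSum_iterate hq hβ hγ hδ h N).symm

/-- The evaluation up to the value at the origin: by symmetry, `δ`, `γ` and `β` are sent to `0` one
after the other. -/
theorem wpSum_eq (H : WellPoised p q v c m) (hq : ‖q‖ < 1) {β γ δ : ℂ}
    (hβ : Admissible p q β) (hγ : Admissible p q γ) (hδ : Admissible p q δ)
    (h : ‖p * β * γ * δ‖ < 1) :
    wpSum p q v c m β γ δ = wpSum p q v c m 0 0 0 *
      (qPochInf (p * β * γ) q * qPochInf (p * β * δ) q * qPochInf (p * γ * δ) q) /
      (qPochInf (p * β) q * qPochInf (p * γ) q * qPochInf (p * δ) q *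
        qPochInf (p * β * γ * δ) q) := by
  have h0 := Admissible.zero p q
  have e1 := H.wpSum_eq_zero_right hq hβ hγ hδ h
  have e2 := H.wpSum_eq_zero_right hq hβ h0 hγ (by simp)
  have e3 := H.wpSum_eq_zero_right hq h0 h0 hβ (by simp)
  rw [← H.wpSum_swap_right] at e2
  rw [← H.wpSum_swap_right, H.wpSum_swap_left] at e3
  simp only [mul_zero, zero_mul, qPochInf_zero, mul_one, one_mul] at e2 e3
  have n1 := qPochInf_ne_zero hq hβ
  have n2 := qPochInf_ne_zero hq hγ
  have n3 := qPochInf_ne_zero hq hδ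
  have n4 : qPochInf (p * β * γ * δ) q ≠ 0 := qPochInf_ne_zero hq fun k hk => by
    have := norm_mul_pow_lt_one hq h k
    rw [← sub_eq_zero.1 hk, norm_one] at this
    exact lt_irrefl _ this
  rw [eq_div_iff (by simp [*])]
  linear_combination qPochInf (p * β) q * qPochInf (p * γ) q * e1 +
    qPochInf (p * β) q * qPochInf (p * β * δ) q * qPochInf (p * γ * δ) q * e2 +
    qPochInf (p * β * δ) q * qPochInf (p * γ * δ) q * qPochInf (p * β * γ) q * e3

end WellPoised

/-- For `δ = q^m` every term with `n > m` vanishes. -/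
theorem wpSum_pow {p q : ℂ} {v : ℕ → ℂ} {c : ℂ → ℂ → ℂ → ℂ} {m : ℕ} {β γ : ℂ} :
    wpSum p q v c m β γ (q ^ m) = c β γ (q ^ m) := by
  have h : ∀ j, wpFactor p q (q ^ m) (j + m + 1) = 0 := fun j =>
    Finset.prod_eq_zero (Finset.mem_range.2 (by omega : m < j + m + 1)) (by simp)
  simp [wpSum, wpTerm, h]

/-- The value at the origin is read off from the terminating case `δ = q^m`. -/
theorem WellPoised.wpSum_zero {p q : ℂ} {v : ℕ → ℂ} {c : ℂ → ℂ → ℂ → ℂ} {m : ℕ}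
    (H : WellPoised p q v c m) (hq : ‖q‖ < 1) (hp : p * q ^ m = q) (hc : c 0 0 (q ^ m) = 1) :
    wpSum p q v c m 0 0 0 = qPochInf q q := by
  have hδ : Admissible p q (q ^ m) := fun k => by
    rw [hp, ← pow_succ']
    exact one_sub_pow_succ_ne_zero hq k
  have h0 := Admissible.zero p q
  have := H.wpSum_eq_zero_right hq h0 h0 hδ (by simp)
  simpa [wpSum_pow, hc, hp, qPochInf_zero] using this.symm

/-! ### The two families of weights -/

/-- The weights of the folded bilateral series: here `p = q`, that is, `a = 1`. -/
theorem wellPoised_bilateral {q : ℂ} (hq : ‖q‖ < 1) :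
    WellPoised q q (fun j => 1 / (1 - q ^ (j + 1))) (fun _ _ _ => 1) 0 where
  tendsto_one := by
    have := (((tendsto_add_atTop_iff_nat 1).2 (tendsto_pow_q hq)).const_sub 1).inv₀ (by simp)
    simpa using this
  weight_succ j _ := by
    have h1 := one_sub_pow_succ_ne_zero hq j
    have h2 := one_sub_pow_succ_ne_zero hq (j + 1)
    rw [← pow_succ', one_div_mul_cancel h1, one_div_mul_cancel h2]
  swap_left _ _ _ := rfl
  swap_right _ _ _ := rfl
  initial β γ δ _ _ hδ := by
    have h1 := one_sub_pow_succ_ne_zero hq 0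
    have h2 := hδ 0
    simp only [wpFlux, wpFactor, Finset.prod_range_zero, pow_zero, mul_one, zero_add] at *
    rw [one_div_mul_cancel h1]
    field_simp
    ring
  initial_tendsto _ _ _ _ := tendsto_const_nhds

/-- The constant `C_0` in terms of `β = 1 / b`, `γ = 1 / c`, `δ = 1 / d`. -/
def lambertInit (q β γ δ : ℂ) : ℂ :=
  (2 * q - 1 - q * (β + γ + δ) + (β * γ + β * δ + γ * δ) + (q - 2) * (β * γ * δ)) /
    ((1 - q) * (β - 1) * (γ - 1) * (δ - 1))

/-- The weights of the series with the factor `lambertFactor`: here `p = 1`, that is, `a = 1 / q`,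
where the well-poised terms with `n ≥ 2` all carry the factor `1 - a q = 0`, and the weights are
what is left once it is removed. -/
theorem wellPoised_lambert {q : ℂ} (hq : ‖q‖ < 1) :
    WellPoised 1 q (fun j => 1 / ((1 - q ^ j) * (1 - q ^ (j + 1)))) (lambertInit q) 1 where
  tendsto_one := by
    have := (((tendsto_pow_q hq).const_sub 1).mul
      (((tendsto_add_atTop_iff_nat 1).2 (tendsto_pow_q hq)).const_sub 1)).inv₀ (by simp)
    simpa using this
  weight_succ j hj := by
    obtain ⟨i, rfl⟩ := Nat.exists_eq_add_of_le' hj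
    have h0 := one_sub_pow_succ_ne_zero hq i
    have h1 := one_sub_pow_succ_ne_zero hq (i + 1)
    have h2 := one_sub_pow_succ_ne_zero hq (i + 2)
    rw [one_mul, div_mul_eq_mul_div, div_mul_eq_mul_div,
      div_eq_div_iff (mul_ne_zero h1 h2) (mul_ne_zero h0 h1)]
    ring
  swap_left β γ δ := by simp only [lambertInit]; congr 1 <;> ring
  swap_right β γ δ := by simp only [lambertInit]; congr 1 <;> ring
  initial β γ δ hβ hγ hδ := by
    have h1 : 1 - q ≠ 0 := by simpa using one_sub_pow_succ_ne_zero hq 0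
    have h2 := one_sub_pow_succ_ne_zero hq 1
    have b0 := sub_ne_zero.2 (sub_ne_zero.1 (hβ 0)).symm
    have c0 := sub_ne_zero.2 (sub_ne_zero.1 (hγ 0)).symm
    have d0 := sub_ne_zero.2 (sub_ne_zero.1 (hδ 0)).symm
    have d1 := sub_ne_zero.2 (sub_ne_zero.1 (hδ 1)).symm
    have B := hβ 0
    have C := hγ 0
    have D := hδ 0
    have D1 := hδ 1
    simp only [wpFlux, wpFactor, Finset.prod_range_one, lambertInit, pow_zero, pow_one, one_mul,
      mul_one] at *
    have e : ∀ x : ℂ, 1 - x ≠ 0 → (x - 1) / (1 - x) = -1 := fun x hx => by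
      rw [← neg_sub, neg_div, div_self hx]
    rw [e β B, e γ C, e δ D, one_div_mul_eq_div, div_mul_cancel_right₀ h2]
    field_simp
    ring
  initial_tendsto β γ hβ hγ := by
    have h1 : 1 - q ≠ 0 := by simpa using one_sub_pow_succ_ne_zero hq 0
    have b0 := sub_ne_zero.2 (sub_ne_zero.1 (hβ 0)).symm
    have c0 := sub_ne_zero.2 (sub_ne_zero.1 (hγ 0)).symm
    simp only [one_mul, pow_zero, mul_one] at b0 c0
    have : ContinuousAt (lambertInit q β γ) 0 := by
      unfold lambertInit
      refine ContinuousAt.div (by fun_prop) (by fun_prop) ?_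
      simp [h1, b0, c0]
    exact this

/-! ### The bilateral summation -/

theorem wpFactor_one_div {b : ℂ} (p q : ℂ) (hb : b ≠ 0) (n : ℕ) :
    wpFactor p q (1 / b) n = qPoch b q n / qPoch (p / b) q n * (1 / b) ^ n := by
  change _ = (∏ k ∈ Finset.range n, (1 - b * q ^ k)) /
    (∏ k ∈ Finset.range n, (1 - p / b * q ^ k)) * (1 / b) ^ n
  rw [← Finset.prod_div_distrib, ← Finset.card_range n, ← Finset.prod_const,
    Finset.card_range, ← Finset.prod_mul_distrib]
  refine Finset.prod_congr rfl fun k _ => ?_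
  rw [mul_one_div, div_mul_eq_mul_div]
  field_simp

/-- The reflection `n ↦ -n`. It also holds where `(q / b; q)_(-n)` is the inverse of a product with
a zero factor: the junk value `0⁻¹ = 0` and division by it give `0`, the correct value of the
quotient. -/
theorem qPoch_negSucc_div {b q : ℂ} (hq0 : q ≠ 0) (hb : b ≠ 0)
    (hA : Admissible q q (1 / b)) (j : ℕ) :
    qPoch b q (Int.negSucc j) / qPoch (q / b) q (Int.negSucc j) * b ^ (j + 1) =
      q ^ (j + 1) * wpFactor q q (1 / b) (j + 1) := by
  simp only [qPoch, wpFactor, div_inv_eq_mul]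
  rw [← Finset.prod_inv_distrib, ← Finset.prod_mul_distrib]
  conv_lhs => rw [← Finset.card_range (j + 1), ← Finset.prod_const, Finset.card_range,
    ← Finset.prod_mul_distrib]
  conv_rhs => rw [← Finset.card_range (j + 1), ← Finset.prod_const, Finset.card_range,
    ← Finset.prod_mul_distrib]
  refine Finset.prod_congr rfl fun k _ => ?_
  have h := hA k
  have h1 : 1 - q * (1 / b) * q ^ k = (b - q * q ^ k) / b := by field_simp
  rw [h1] at h ⊢
  have h2 : b - q * q ^ k ≠ 0 := fun h' => h (by rw [h', zero_div])
  have h3 : 1 - b / q ^ (k + 1) = -((b - q * q ^ k) / (q * q ^ k)) := by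
    rw [pow_succ']
    field_simp
    ring
  rw [h3, pow_succ']
  have h4 := pow_ne_zero k hq0
  field_simp
  ring

/-- The bilateral series has `n`-th term `u n` and `-n`-th term `q^n * u n`; folding it gives the
weight `1 + q^n = (1 - q^(2n)) / (1 - q^n)` of `wellPoised_bilateral`. -/
theorem hasSum_psiTerm {q b c d : ℂ} (hq0 : q ≠ 0) (hq : ‖q‖ < 1) (hb : b ≠ 0) (hc : c ≠ 0)
    (hd : d ≠ 0) (hb' : Admissible q q (1 / b)) (hc' : Admissible q q (1 / c))
    (hd' : Admissible q q (1 / d)) (h : ‖q / (b * c * d)‖ < 1) :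
    HasSum (psiTerm ![b, c, d] ![q / b, q / c, q / d] q (q / (b * c * d)))
      (qPochInfMulti ![q, q / (b * c), q / (b * d), q / (c * d)] q /
          qPochInfMulti ![q / b, q / c, q / d, q / (b * c * d)] q) := by
  have H := wellPoised_bilateral hq
  have h' : ‖q * (1 / b) * (1 / c) * (1 / d)‖ < 1 := by
    convert h using 2
    field_simp
  have hF := H.wpSum_eq hq hb' hc' hd' h'
  rw [H.wpSum_zero hq (by simp) rfl] at hF
  -- the terms of index `n ≥ 0`
  set u : ℕ → ℂ := fun j => q ^ j *
    (wpFactor q q (1 / b) j * wpFactor q q (1 / c) j * wpFactor q q (1 / d) j) with hu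
  have su : Summable u := (summable_wpProduct hq h').of_norm
  have st := summable_wpTerm hq H.tendsto_one h'
  have e : ∀ j, wpTerm q q (fun j => 1 / (1 - q ^ (j + 1))) (1 / b) (1 / c) (1 / d) j =
      u (j + 1) + q ^ (j + 1) * u (j + 1) := fun j => by
    have h1 := one_sub_pow_succ_ne_zero hq j
    have h2 : 1 - q * q ^ (2 * j + 1) = (1 + q ^ (j + 1)) * (1 - q ^ (j + 1)) := by ring
    simp only [wpTerm, hu]
    rw [h2, mul_assoc (1 + q ^ (j + 1)), mul_one_div_cancel h1]
    ring
  have su1 := (summable_nat_add_iff 1).2 su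
  have sv : Summable fun j => q ^ (j + 1) * u (j + 1) := by
    refine (st.sub su1).congr fun j => ?_
    rw [e, add_sub_cancel_left]
  have hpos : ∀ n : ℕ, psiTerm ![b, c, d] ![q / b, q / c, q / d] q (q / (b * c * d)) n = u n :=
    fun n => by
      simp only [hu, wpFactor_one_div q q hb, wpFactor_one_div q q hc, wpFactor_one_div q q hd,
        psiTerm, qPochMulti, Fin.prod_univ_three, zpow_natCast, div_pow, mul_pow, one_pow]
      simp only [Matrix.cons_val]
      ring
  have hneg : ∀ j : ℕ, psiTerm ![b, c, d] ![q / b, q / c, q / d] q (q / (b * c * d))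
      (-((j : ℤ) + 1)) = q ^ (j + 1) * u (j + 1) := fun j => by
    have e1 := qPoch_negSucc_div hq0 hb hb' j
    have e2 := qPoch_negSucc_div hq0 hc hc' j
    have e3 := qPoch_negSucc_div hq0 hd hd' j
    have hQ := pow_ne_zero (j + 1) hq0
    rw [← Int.negSucc_eq]
    simp only [psiTerm, qPochMulti, Fin.prod_univ_three, zpow_negSucc, div_pow, mul_pow, inv_div,
      Matrix.cons_val, hu]
    rw [mul_div_mul_comm, mul_div_mul_comm]
    calc _ = (qPoch b q (Int.negSucc j) / qPoch (q / b) q (Int.negSucc j) * b ^ (j + 1)) *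
          (qPoch c q (Int.negSucc j) / qPoch (q / c) q (Int.negSucc j) * c ^ (j + 1)) *
          (qPoch d q (Int.negSucc j) / qPoch (q / d) q (Int.negSucc j) * d ^ (j + 1)) /
          q ^ (j + 1) := by ring
      _ = _ := by
        rw [e1, e2, e3]
        field_simp
  have key := HasSum.of_nat_of_neg_add_one
    (f := psiTerm ![b, c, d] ![q / b, q / c, q / d] q (q / (b * c * d)))
    (by simpa only [hpos] using su.hasSum) (by simpa only [hneg] using sv.hasSum)
  convert key using 1
  have hval : wpSum q q (fun j => 1 / (1 - q ^ (j + 1))) (fun _ _ _ => 1) 0 (1 / b) (1 / c) (1 / d)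
      = ∑' n, u n + ∑' j, q ^ (j + 1) * u (j + 1) := by
    rw [wpSum, su.tsum_eq_zero_add, add_assoc, ← su1.tsum_add sv]
    simp only [add_zero, e]
    simp [hu, wpFactor]
  rw [← hval, hF]
  simp only [qPochInfMulti, Fin.prod_univ_four, Matrix.cons_val, mul_one_div, div_div]
  simp only [mul_assoc]

/-! ### The summation with the Lambert factor -/

theorem hasSum_lambert {q β γ δ : ℂ} (hq : ‖q‖ < 1) (hβ : Admissible 1 q β)
    (hγ : Admissible 1 q γ) (hδ : Admissible 1 q δ) (h : ‖β * γ * δ‖ < 1) :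
    HasSum (fun n : {n : ℕ // 2 ≤ n} => lambertFactor q n *
        (wpFactor 1 q β n * wpFactor 1 q γ n * wpFactor 1 q δ n))
      (qPochInf q q * (qPochInf (β * γ) q * qPochInf (β * δ) q * qPochInf (γ * δ) q) /
        (qPochInf β q * qPochInf γ q * qPochInf δ q * qPochInf (β * γ * δ) q)
        - lambertInit q β γ δ) := by
  have H := wellPoised_lambert hq
  have h1 : 1 - q ≠ 0 := by simpa using one_sub_pow_succ_ne_zero hq 0
  have hF := H.wpSum_eq hq hβ hγ hδ (by simpa using h)
  rw [H.wpSum_zero hq (by simp) ?_] at hF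
  · simp only [one_mul] at hF
    refine hasSum_subtype_two_le (f := fun n => lambertFactor q n *
        (wpFactor 1 q β n * wpFactor 1 q γ n * wpFactor 1 q δ n)) ?_
    rw [← hF, wpSum, add_sub_cancel_left]
    refine ((summable_nat_add_iff 1).2
      (summable_wpTerm hq H.tendsto_one (by simpa using h))).hasSum.congr_fun ?_
    intro j
    simp only [wpTerm, lambertFactor, one_pow, one_mul, mul_one_div]
    rfl
  · have : q - 1 ≠ 0 := sub_ne_zero.2 (sub_ne_zero.1 h1).symm
    simp only [lambertInit, pow_one]
    field_simp
    ring

theorem wpFactor_zero_cube (p q : ℂ) (n : ℕ) :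
    wpFactor p q 0 n * wpFactor p q 0 n * wpFactor p q 0 n =
      (-1) ^ n * q ^ (3 * n * (n - 1) / 2) := by
  have h : wpFactor p q 0 n = (-1) ^ n * q ^ (∑ k ∈ Finset.range n, k) := by
    rw [← Finset.prod_pow_eq_pow_sum]
    simp [wpFactor, Finset.prod_neg]
  have h2 : 3 * n * (n - 1) / 2 = 3 * ∑ k ∈ Finset.range n, k := by
    refine Nat.div_eq_of_eq_mul_left two_pos ?_
    rw [mul_assoc, mul_assoc, Finset.sum_range_id_mul_two]
  have h3 : ((-1 : ℂ) ^ n) * (-1) ^ n = 1 := by rw [← mul_pow]; simp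
  rw [h, h2, pow_mul']
  linear_combination (-1) ^ n * (q ^ (∑ k ∈ Finset.range n, k)) ^ 3 * h3

theorem admissible_one_div {p q b : ℂ} (hb : b ≠ 0) (h : ∀ k : ℕ, b ≠ p * q ^ k) :
    Admissible p q (1 / b) := fun k hk => by
  refine h k ?_
  field_simp at hk
  linear_combination hk

theorem lambertInit_one_div {q b c d : ℂ} (hb : b ≠ 0) (hc : c ≠ 0) (hd : d ≠ 0) :
    lambertInit q (1 / b) (1 / c) (1 / d) = constC q b c d := by
  have e : ∀ x : ℂ, x ≠ 0 → 1 / x - 1 = (1 - x) / x := fun x hx => by field_simp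
  rw [lambertInit, constC, e b hb, e c hc, e d hd,
    ← mul_div_mul_right _ ((1 - q) * ((1 - b) / b) * ((1 - c) / c) * ((1 - d) / d))
      (mul_ne_zero (mul_ne_zero hb hc) hd)]
  congr 1
  · field_simp
    ring
  · field_simp

theorem hasSum_lambert_one_div {q b c d : ℂ} (hq : ‖q‖ < 1) (hb : b ≠ 0) (hc : c ≠ 0) (hd : d ≠ 0)
    (hbcd : ∀ k : ℕ, b ≠ q ^ k ∧ c ≠ q ^ k ∧ d ≠ q ^ k) (h : ‖1 / (b * c * d)‖ < 1) :
    HasSum (fun n : {n : ℕ // 2 ≤ n} =>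
        lambertFactor q n *
          (qPochMulti ![b, c, d] q (n : ℕ) / qPochMulti ![1 / b, 1 / c, 1 / d] q (n : ℕ)) *
          (1 / (b * c * d)) ^ (n : ℕ))
      (qPochInfMulti ![q, 1 / (b * c), 1 / (b * d), 1 / (c * d)] q /
          qPochInfMulti ![1 / b, 1 / c, 1 / d, 1 / (b * c * d)] q - constC q b c d) := by
  have key := hasSum_lambert hq (admissible_one_div (p := 1) hb (by simpa using fun k => (hbcd k).1))
    (admissible_one_div (p := 1) hc (by simpa using fun k => (hbcd k).2.1))
    (admissible_one_div (p := 1) hd (by simpa using fun k => (hbcd k).2.2))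
    (by convert h using 2; field_simp)
  rw [lambertInit_one_div hb hc hd] at key
  convert key using 1
  · funext n
    simp only [wpFactor_one_div 1 q hb, wpFactor_one_div 1 q hc, wpFactor_one_div 1 q hd,
        qPochMulti, Fin.prod_univ_three, div_pow, mul_pow, one_pow, Matrix.cons_val]
    ring
  · simp only [qPochInfMulti, Fin.prod_univ_four, Matrix.cons_val, mul_one_div, div_div]
    rw [mul_assoc (qPochInf q q), mul_assoc (qPochInf q q)]

theorem hasSum_lambert_cube {q b : ℂ} (hq : ‖q‖ < 1) (hb : 1 < ‖b‖) :
    HasSum (fun n : {n : ℕ // 2 ≤ n} =>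
        lambertFactor q n * (qPoch b q (n : ℕ) ^ 3 / qPoch (1 / b) q (n : ℕ) ^ 3) *
          (1 / b) ^ (3 * (n : ℕ)))
      (qPochInf q q * (qPochInf (-1 / b) q ^ 3 * qPochInf (q / b ^ 2) (q ^ 2) ^ 3 /
          qPochInf (1 / b ^ 3) q) +
          (-2 * b * q + b - q + 2) / ((1 - b) * (1 - q))) := by
  have hb0 : b ≠ 0 := norm_pos_iff.1 (one_pos.trans hb)
  have hbk : ∀ k : ℕ, b ≠ q ^ k := fun k h => by
    rw [h, norm_pow] at hb
    exact absurd hb (pow_le_one₀ (norm_nonneg _) hq.le).not_gt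
  have hA : Admissible 1 q (1 / b) := admissible_one_div hb0 (by simpa using hbk)
  have hn : ‖1 / b‖ < 1 := by
    rw [norm_div, norm_one, div_lt_one (one_pos.trans hb)]
    exact hb
  have key := hasSum_lambert hq hA hA hA (by
    rw [norm_mul, norm_mul]
    exact mul_lt_one_of_nonneg_of_lt_one_right
      (mul_le_one₀ hn.le (norm_nonneg _) hn.le) (norm_nonneg _) hn)
  rw [lambertInit_one_div hb0 hb0 hb0] at key
  have hP : qPochInf (1 / b) q ≠ 0 := qPochInf_ne_zero hq (by simpa [Admissible] using hA)
  have h1 : 1 - q ≠ 0 := by simpa using one_sub_pow_succ_ne_zero hq 0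
  have h2 : 1 - b ≠ 0 := sub_ne_zero.2 (by simpa using (hbk 0).symm)
  convert key using 1
  · funext n
    simp only [wpFactor_one_div 1 q hb0, div_pow, one_pow, pow_mul']
    ring
  · have e1 := qPochInf_sq hq (1 / b)
    rw [← neg_div, one_div_pow, mul_one_div] at e1
    have e2 : 1 / b * (1 / b) = 1 / b ^ 2 := by field_simp
    have e3 : 1 / b ^ 2 * (1 / b) = 1 / b ^ 3 := by field_simp
    have e4 : constC q b b b = -((-2 * b * q + b - q + 2) / ((1 - b) * (1 - q))) := by
      rw [constC]
      field_simp
      ring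
    rw [e2, e3, e1, e4, sub_neg_eq_add]
    congr 1
    generalize qPochInf (1 / b) q = P at hP
    rw [← mul_div_assoc, ← mul_div_mul_left _ (qPochInf (1 / b ^ 3) q)
      (mul_ne_zero (mul_ne_zero hP hP) hP)]
    congr 1
    ring

theorem hasSum_lambert_zero {q : ℂ} (hq : ‖q‖ < 1) :
    HasSum (fun n : {n : ℕ // 2 ≤ n} =>
        lambertFactor q n * (-1) ^ (n : ℕ) * q ^ (3 * (n : ℕ) * ((n : ℕ) - 1) / 2))
      (qPochInf q q - (1 - 2 * q) / (1 - q)) := by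
  have h0 := Admissible.zero 1 q
  have key := hasSum_lambert hq h0 h0 h0 (by simp)
  simp only [wpFactor_zero_cube, ← mul_assoc] at key
  convert key using 1
  have h1 : 1 - q ≠ 0 := by simpa using one_sub_pow_succ_ne_zero hq 0
  simp only [lambertInit, qPochInf_zero, mul_zero]
  field_simp
  ring

end WellPoisedSeries

theorem mainTheorem6 (q : ℂ) (hq0 : q ≠ 0) (hq1 : ‖q‖ < 1) :
    -- the bilateral summation
    (∀ b c d : ℂ, b ≠ 0 → c ≠ 0 → d ≠ 0 →
      (∀ k : ℕ, 1 ≤ k → b ≠ q ^ k ∧ c ≠ q ^ k ∧ d ≠ q ^ k) →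
      ‖q / (b * c * d)‖ < 1 →
      Summable (psiTerm ![b, c, d] ![q / b, q / c, q / d] q (q / (b * c * d))) ∧
      bilateralPsi ![b, c, d] ![q / b, q / c, q / d] q (q / (b * c * d)) =
        qPochInfMulti ![q, q / (b * c), q / (b * d), q / (c * d)] q /
          qPochInfMulti ![q / b, q / c, q / d, q / (b * c * d)] q) ∧
    -- the summation with the constant `C_0`
    (∀ b c d : ℂ, b ≠ 0 → c ≠ 0 → d ≠ 0 →
      (∀ k : ℕ, b ≠ q ^ k ∧ c ≠ q ^ k ∧ d ≠ q ^ k) →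
      ‖1 / (b * c * d)‖ < 1 →
      Summable (fun n : {n : ℕ // 2 ≤ n} =>
        lambertFactor q n *
          (qPochMulti ![b, c, d] q (n : ℕ) / qPochMulti ![1 / b, 1 / c, 1 / d] q (n : ℕ)) *
          (1 / (b * c * d)) ^ (n : ℕ)) ∧
      constC q b c d + ∑' n : {n : ℕ // 2 ≤ n},
        lambertFactor q n *
          (qPochMulti ![b, c, d] q (n : ℕ) / qPochMulti ![1 / b, 1 / c, 1 / d] q (n : ℕ)) *
          (1 / (b * c * d)) ^ (n : ℕ) =
        qPochInfMulti ![q, 1 / (b * c), 1 / (b * d), 1 / (c * d)] q /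
          qPochInfMulti ![1 / b, 1 / c, 1 / d, 1 / (b * c * d)] q) ∧
    -- the specialization `b = c = d`
    (∀ b : ℂ, 1 < ‖b‖ →
      Summable (fun n : {n : ℕ // 2 ≤ n} =>
        lambertFactor q n * (qPoch b q (n : ℕ) ^ 3 / qPoch (1 / b) q (n : ℕ) ^ 3) *
          (1 / b) ^ (3 * (n : ℕ))) ∧
      ∑' n : {n : ℕ // 2 ≤ n},
        lambertFactor q n * (qPoch b q (n : ℕ) ^ 3 / qPoch (1 / b) q (n : ℕ) ^ 3) *
          (1 / b) ^ (3 * (n : ℕ)) =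
        qPochInf q q * (qPochInf (-1 / b) q ^ 3 * qPochInf (q / b ^ 2) (q ^ 2) ^ 3 /
          qPochInf (1 / b ^ 3) q) +
          (-2 * b * q + b - q + 2) / ((1 - b) * (1 - q))) ∧
    -- the limiting case `b, c, d → ∞`
    (Summable (fun n : {n : ℕ // 2 ≤ n} =>
        lambertFactor q n * (-1) ^ (n : ℕ) * q ^ (3 * (n : ℕ) * ((n : ℕ) - 1) / 2)) ∧
      ∑' n : {n : ℕ // 2 ≤ n},
        lambertFactor q n * (-1) ^ (n : ℕ) * q ^ (3 * (n : ℕ) * ((n : ℕ) - 1) / 2) =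
        qPochInf q q - (1 - 2 * q) / (1 - q)) := by
  refine ⟨fun b c d hb hc hd h hx => ?_, fun b c d hb hc hd h hx => ?_, fun b hb => ?_, ?_⟩
  · have hA : ∀ x : ℂ, x ≠ 0 → (∀ k : ℕ, 1 ≤ k → x ≠ q ^ k) → Admissible q q (1 / x) :=
      fun x hx0 hxk => admissible_one_div hx0 fun k => by
        rw [← pow_succ']
        exact hxk _ k.succ_pos
    have key := hasSum_psiTerm hq0 hq1 hb hc hd (hA b hb fun k hk => (h k hk).1)
      (hA c hc fun k hk => (h k hk).2.1) (hA d hd fun k hk => (h k hk).2.2) hx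
    exact ⟨key.summable, key.tsum_eq⟩
  · have key := hasSum_lambert_one_div hq1 hb hc hd h hx
    refine ⟨key.summable, ?_⟩
    rw [key.tsum_eq, add_sub_cancel]
  · have key := hasSum_lambert_cube hq1 hb
    exact ⟨key.summable, key.tsum_eq⟩
  · have key := hasSum_lambert_zero hq1
    exact ⟨key.summable, key.tsum_eq⟩
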